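/- For a finite group $G$ let $L(G)$ be its lattice of subgroups and $k'(G)$ the number of conjugacy classes of subgroups of $G$, and put $$d'(G)=\frac{k'(G)}{|L(G)|},\qquad d^*(G)=\min\{\,d'(S)\mid S\text{ is a section of }G\,\},$$ where a section of $G$ is a quotient $H/N$ with $H\le G$ and $N\trianglelefteq H$. Then $d^*(D_8)=d'(D_8)=\frac45$, where $D_8$ is the dihedral group of order $8$. Moreover, if $G$ is a finite group with $d^*(G)>\frac45$, then $G$ is an Iwasawa group, i.e. $G$ is nilpotent and its subgroup lattice $L(G)$ is modular. -/

import Mathlib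

open scoped Pointwise

namespace FiniteGroupRatio

/-- The number `k'(G)` of conjugacy classes of subgroups of `G`: the number of orbits of `G` acting
by conjugation on its set of subgroups. -/
noncomputable def numSubgroupClasses (G : Type*) [Group G] : ℕ :=
  Nat.card (MulAction.orbitRel.Quotient (ConjAct G) (Subgroup G))

/-- The ratio `d'(G) = k'(G) / |L(G)|`, where `L(G)` is the subgroup lattice of `G`. -/
noncomputable def dPrime (G : Type*) [Group G] : ℝ :=
  (numSubgroupClasses G : ℝ) / (Nat.card (Subgroup G) : ℝ)

/-- The set of the values `d'(S)`, where `S = H / N` runs through the sections of `G`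
(`H` a subgroup of `G` and `N` a normal subgroup of `H`). -/
def sectionValues (G : Type*) [Group G] : Set ℝ :=
  {x | ∃ (H : Subgroup G) (N : Subgroup H) (_ : N.Normal), x = dPrime (H ⧸ N)}

/-- `d*(G)`, the minimum of `d'(S)` over all sections `S` of the finite group `G`; the infimum is
attained, see `isLeast_dStar`. -/
noncomputable def dStar (G : Type*) [Group G] : ℝ :=
  sInf (sectionValues G)

/-- An Iwasawa group: a nilpotent group whose subgroup lattice is modular. -/
def IsIwasawa (G : Type*) [Group G] : Prop :=
  Group.IsNilpotent G ∧ IsModularLattice (Subgroup G)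

/-- Two subgroups lie in the same class exactly when one is `g K g⁻¹` for the other one `K`. -/
theorem orbitRel_iff {G : Type*} [Group G] (H K : Subgroup G) :
    MulAction.orbitRel (ConjAct G) (Subgroup G) H K ↔
      ∃ g : G, K.map (MulAut.conj g).toMonoidHom = H :=
  Iff.rfl

/-- For a finite group, `d*(G)` is a genuine minimum. -/
theorem isLeast_dStar (G : Type*) [Group G] [Finite G] :
    IsLeast (sectionValues G) (dStar G) := by
  have hfin : (sectionValues G).Finite := by
    classical
    refine (Set.finite_range (fun p : Σ H : Subgroup G, {N : Subgroup H // N.Normal} =>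
      haveI := p.2.2
      dPrime (p.1 ⧸ p.2.1))).subset ?_
    rintro x ⟨H, N, hN, rfl⟩
    exact ⟨⟨H, N, hN⟩, rfl⟩
  have hne : (sectionValues G).Nonempty := ⟨_, ⊤, ⊥, inferInstance, rfl⟩
  exact ⟨hne.csInf_mem hfin, fun x hx => csInf_le hfin.bddBelow hx⟩

end FiniteGroupRatio

/-!
The argument uses a single consequence of `d*(G) > 4/5`. A conjugacy class of subgroups is either
one normal subgroup or has at least two members, so `d'(K) > 4/5` forces more than three fifths of
the subgroups of `K` to be normal; this therefore holds in every section `K` of `G`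
(`MostlyNormalSections`), and it passes to sections, which allows induction on the order.

Nilpotency (`MostlyNormalSections.isNilpotent`): if `G` is not nilpotent but all its proper
quotients are, there is a nonnormal maximal subgroup `M` of trivial core. The map `K ↦ K ⊓ M` is
injective on nontrivial normal subgroups, so `G` has at most `m + 1` normal subgroups, where `m` is
the number of subgroups of `M`, and at least `m` nonnormal ones: the nontrivial subgroups of `M`
and another conjugate of `M`. Since `m ≥ 2`, this is too many.

Modularity: it suffices that the subgroups of `G` permute, by Dedekind's law
(`isModularLattice_of_permute`), and because `G` is nilpotent this reduces to cyclic subgroups of a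
`p`-group. A minimal `p`-group with cyclic subgroups `⟨x⟩`, `⟨y⟩` that do not permute is generated
by `x` and `y`, and `⟨x⟩⟨y⟩` contains no central element of order `p`, since modulo such an element
the two do permute. This forces `x` and `y` to have order `p` (`pow_eq_one_of_forall_center`), so
the group is nonabelian of order `p ^ 3` and generated by elements of order `p`. It then has at most
`p + 4` normal subgroups and at least `2 * p` others (`ncard_normal_le`,
`two_mul_le_ncard_not_normal`), again too many. The dihedral group of order `8` has `6` and `4` of
them, which is the extremal case.

For the dihedral group of order `8` itself, the `10` subgroups and their `8` classes are enumerated,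
and every other section is abelian, with ratio `1`.
-/

open scoped Pointwise

namespace FiniteGroupRatio

universe u

/-! ### Sections and the number of normal subgroups -/

theorem dPrime_congr {G K : Type*} [Group G] [Group K] (e : G ≃* K) : dPrime G = dPrime K := by
  have h1 : Nat.card (Subgroup G) = Nat.card (Subgroup K) :=
    Nat.card_congr e.mapSubgroup.toEquiv
  have h2 : numSubgroupClasses G = numSubgroupClasses K := by
    refine Nat.card_congr (Quotient.congr e.mapSubgroup.toEquiv fun A B => ?_)
    refine (orbitRel_iff A B).trans
      (Iff.trans ?_ (orbitRel_iff (e.mapSubgroup A) (e.mapSubgroup B)).symm)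
    have key : ∀ g : G, (B.map e.toMonoidHom).map (MulAut.conj (e g)).toMonoidHom =
        (B.map (MulAut.conj g).toMonoidHom).map e.toMonoidHom := by
      intro g
      rw [Subgroup.map_map, Subgroup.map_map]
      congr 1
      ext x
      simp
    constructor
    · rintro ⟨g, rfl⟩
      exact ⟨e g, key g⟩
    · rintro ⟨k, hk⟩
      obtain ⟨g, rfl⟩ := e.surjective k
      exact ⟨g, Subgroup.map_injective e.injective ((key g).symm.trans hk)⟩
  rw [dPrime, dPrime, h1, h2]

/-- `K` is (isomorphic to) a section of `G`: a homomorphic image of a subgroup of `G`. -/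
def IsSection (K G : Type*) [Group K] [Group G] : Prop :=
  ∃ (H : Subgroup G) (f : H →* K), Function.Surjective f

theorem IsSection.refl (G : Type*) [Group G] : IsSection G G :=
  ⟨⊤, (⊤ : Subgroup G).subtype, fun g => ⟨⟨g, trivial⟩, rfl⟩⟩

theorem IsSection.trans_subgroup {K G : Type*} [Group K] [Group G] {H : Subgroup G}
    (h : IsSection K H) : IsSection K G := by
  obtain ⟨A, f, hf⟩ := h
  let e := A.equivMapOfInjective H.subtype H.subtype_injective
  exact ⟨A.map H.subtype, f.comp e.symm.toMonoidHom, hf.comp e.symm.surjective⟩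

theorem IsSection.trans_quotient {K G : Type*} [Group K] [Group G] {N : Subgroup G} [N.Normal]
    (h : IsSection K (G ⧸ N)) : IsSection K G := by
  obtain ⟨A, f, hf⟩ := h
  refine ⟨A.comap (QuotientGroup.mk' N), f.comp ((QuotientGroup.mk' N).subgroupComap A),
    hf.comp ?_⟩
  rintro ⟨a, ha⟩
  obtain ⟨g, rfl⟩ := QuotientGroup.mk'_surjective N a
  exact ⟨⟨g, ha⟩, rfl⟩

theorem IsSection.dStar_le {K G : Type*} [Group K] [Group G] [Finite G] (h : IsSection K G) :
    dStar G ≤ dPrime K := by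
  obtain ⟨H, f, hf⟩ := h
  refine (isLeast_dStar G).2 ⟨H, f.ker, inferInstance, ?_⟩
  exact dPrime_congr (QuotientGroup.quotientKerEquivOfSurjective f hf).symm

theorem eq_of_orbitRel_of_normal {G : Type*} [Group G] {A B : Subgroup G}
    (h : MulAction.orbitRel (ConjAct G) (Subgroup G) A B) (hB : B.Normal) : A = B := by
  obtain ⟨g, rfl⟩ := (orbitRel_iff A B).1 h
  exact Subgroup.Normal.map_conj_eq B g

/-- Every conjugacy class of subgroups either has at least two members or consists of a single
normal subgroup. -/
theorem two_mul_numSubgroupClasses_le (G : Type*) [Group G] [Finite G] :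
    2 * numSubgroupClasses G ≤ Nat.card (Subgroup G) + {H : Subgroup G | H.Normal}.ncard := by
  classical
  have := Fintype.ofFinite (Subgroup G)
  have := Fintype.ofFinite (MulAction.orbitRel.Quotient (ConjAct G) (Subgroup G))
  let π : Subgroup G → MulAction.orbitRel.Quotient (ConjAct G) (Subgroup G) := Quotient.mk _
  have h1 : Fintype.card (Subgroup G) =
      ∑ ω, (Finset.univ.filter fun H => π H = ω).card :=
    Finset.card_eq_sum_card_fiberwise (f := π) (fun _ _ => Finset.mem_univ _)
  have h2 : (Finset.univ.filter fun H : Subgroup G => H.Normal).card =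
      ∑ ω, ((Finset.univ.filter fun H : Subgroup G => H.Normal).filter fun H => π H = ω).card :=
    Finset.card_eq_sum_card_fiberwise (f := π) (fun _ _ => Finset.mem_univ _)
  have h3 : {H : Subgroup G | H.Normal}.ncard =
      (Finset.univ.filter fun H : Subgroup G => H.Normal).card := by
    rw [← Set.ncard_coe_finset]
    simp
  rw [numSubgroupClasses, Nat.card_eq_fintype_card, Nat.card_eq_fintype_card, h3, h1, h2,
    ← Finset.sum_add_distrib, mul_comm, ← Finset.card_univ, ← smul_eq_mul]
  refine Finset.card_nsmul_le_sum _ _ _ fun ω _ => ?_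
  obtain ⟨A, rfl⟩ := Quotient.exists_rep ω
  have hA : A ∈ Finset.univ.filter fun H => π H = π A := by simp
  by_cases hn : A.Normal
  · have e1 := Finset.card_pos.2 ⟨A, hA⟩
    have e2 : 0 < ((Finset.univ.filter fun H : Subgroup G => H.Normal).filter
        fun H => π H = π A).card := Finset.card_pos.2 ⟨A, by simp [hn]⟩
    exact Nat.add_le_add e1 e2
  · refine le_add_right (Finset.one_lt_card.2 ?_)
    obtain ⟨g, hg⟩ := not_forall.1 (mt Subgroup.normal_iff_map_conj_eq.2 hn)
    refine ⟨_, ?_, A, hA, hg⟩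
    simp only [Finset.mem_filter, Finset.mem_univ, true_and]
    exact Quotient.sound ((orbitRel_iff _ _).2 ⟨g, rfl⟩)

/-- If `d'(G) > 4/5`, more than three fifths of the subgroups of `G` are normal. -/
theorem three_mul_ncard_not_normal_lt {G : Type*} [Group G] [Finite G] (h : 4 / 5 < dPrime G) :
    3 * {H : Subgroup G | ¬ H.Normal}.ncard < 2 * {H : Subgroup G | H.Normal}.ncard := by
  have h1 := two_mul_numSubgroupClasses_le G
  have h2 : {H : Subgroup G | H.Normal}.ncard + {H : Subgroup G | ¬ H.Normal}.ncard =
      Nat.card (Subgroup G) := Set.ncard_add_ncard_compl {H : Subgroup G | H.Normal}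
  have h3 : 0 < Nat.card (Subgroup G) := Nat.card_pos
  rw [dPrime, lt_div_iff₀ (by exact_mod_cast h3)] at h
  have h4 : 4 * Nat.card (Subgroup G) < 5 * numSubgroupClasses G := by
    have : (4 : ℝ) * Nat.card (Subgroup G) < 5 * numSubgroupClasses G := by linarith
    exact_mod_cast this
  omega

/-- The hypothesis on `G` that the proof exploits: normal subgroups outnumber the others by more
than three to two in every section of `G`. -/
def MostlyNormalSections (G : Type u) [Group G] : Prop :=
  ∀ (K : Type u) [Group K], IsSection K G →
    3 * {H : Subgroup K | ¬ H.Normal}.ncard < 2 * {H : Subgroup K | H.Normal}.ncard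

theorem mostlyNormalSections_of_lt_dStar {G : Type u} [Group G] [Finite G]
    (h : 4 / 5 < dStar G) : MostlyNormalSections G := by
  intro K _ hK
  have : Finite K := by
    obtain ⟨H, f, hf⟩ := hK
    exact Finite.of_surjective f hf
  exact three_mul_ncard_not_normal_lt (h.trans_le hK.dStar_le)

theorem MostlyNormalSections.subgroup {G : Type u} [Group G] (h : MostlyNormalSections G)
    (H : Subgroup G) : MostlyNormalSections H :=
  fun K _ hK => h K hK.trans_subgroup

theorem MostlyNormalSections.quotient {G : Type u} [Group G] (h : MostlyNormalSections G)
    (N : Subgroup G) [N.Normal] : MostlyNormalSections (G ⧸ N) :=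
  fun K _ hK => h K hK.trans_quotient

/-! ### Nilpotency -/

theorem card_quotient_lt {G : Type*} [Group G] [Finite G] {N : Subgroup G} (hN : N ≠ ⊥) :
    Nat.card (G ⧸ N) < Nat.card G := by
  have h1 := N.card_eq_card_quotient_mul_card_subgroup
  have h2 : 1 < Nat.card N := N.one_lt_card_iff_ne_bot.2 hN
  have h3 : 0 < Nat.card (G ⧸ N) := Nat.card_pos
  nlinarith

theorem isNilpotent_of_quotients {G : Type*} [Group G] {A B : Subgroup G} [A.Normal] [B.Normal]
    (hA : Group.IsNilpotent (G ⧸ A)) (hB : Group.IsNilpotent (G ⧸ B)) (h : A ⊓ B = ⊥) :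
    Group.IsNilpotent G := by
  refine Subgroup.isNilpotent_of_ker_le_center
    ((QuotientGroup.mk' A).prod (QuotientGroup.mk' B)) ?_
  rw [MonoidHom.ker_prod, QuotientGroup.ker_mk', QuotientGroup.ker_mk', h]
  exact bot_le

theorem normal_of_quotient_normalCore {G : Type*} [Group G] {M : Subgroup G} (hM : IsCoatom M)
    (h : Group.IsNilpotent (G ⧸ M.normalCore)) : M.Normal := by
  have hM' : (M.map (QuotientGroup.mk' M.normalCore)).comap (QuotientGroup.mk' M.normalCore) = M :=
    Subgroup.comap_map_eq_self (by rw [QuotientGroup.ker_mk']; exact M.normalCore_le)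
  have hlt := Group.normalizerCondition_of_isNilpotent (M.map (QuotientGroup.mk' M.normalCore))
    (lt_top_iff_ne_top.2 fun h0 => hM.1 (by rw [← hM', h0, Subgroup.comap_top]))
  rw [← Subgroup.comap_lt_comap_of_surjective (QuotientGroup.mk'_surjective M.normalCore),
    Subgroup.comap_normalizer_eq_of_surjective _ (QuotientGroup.mk'_surjective M.normalCore),
    hM'] at hlt
  exact Subgroup.normalizer_eq_top_iff.1 (hM.2 _ hlt)

/-- A minimal counterexample `G` has a nonnormal maximal subgroup `M` of trivial core, and
`K ↦ K ⊓ M` is injective on its nontrivial normal subgroups. So there are at most `m + 1` normal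
subgroups, `m` being the number of subgroups of `M`. On the other hand the nontrivial subgroups of
`M`, and one further conjugate of `M`, are not normal. -/
theorem MostlyNormalSections.isNilpotent {G : Type u} [Group G] [Finite G]
    (h : MostlyNormalSections G) : Group.IsNilpotent G := by
  induction hn : Nat.card G using Nat.strong_induction_on generalizing G with
  | _ n ih =>
  by_contra hG
  have hq : ∀ N : Subgroup G, ∀ _ : N.Normal, N ≠ ⊥ → Group.IsNilpotent (G ⧸ N) :=
    fun N _ hN => ih _ (hn ▸ card_quotient_lt hN) (h.quotient N) rfl
  have hM : ∃ M : Subgroup G, IsCoatom M ∧ ¬ M.Normal := by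
    by_contra! hc
    exact hG (((Group.isNilpotent_of_finite_tfae (G := G)).out 0 2).2 hc)
  obtain ⟨M, hM, hMn⟩ := hM
  have hcore : ∀ K : Subgroup G, K.Normal → K ≤ M → K = ⊥ := by
    intro K hK hKM
    by_contra hne
    have : M.normalCore ≠ ⊥ := fun h0 => hne <| le_bot_iff.1 <| h0 ▸
      (Subgroup.normal_le_normalCore).2 hKM
    exact hMn (normal_of_quotient_normalCore hM (hq _ inferInstance this))
  have hle : ∀ A B : Subgroup G, A.Normal → B.Normal → A ≠ ⊥ → B ≠ ⊥ → A ⊓ M = B ⊓ M → A ≤ B := by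
    intro A B hA hB hA0 hB0 hAB a ha
    have hI : A ⊓ B ≠ ⊥ := fun h0 =>
      hG (isNilpotent_of_quotients (hq A hA hA0) (hq B hB hB0) h0)
    have hsup : (A ⊓ B) ⊔ M = ⊤ := by
      refine hM.2 _ (lt_of_le_of_ne le_sup_right fun he => ?_)
      exact hI (hcore _ inferInstance (he ▸ le_sup_left))
    obtain ⟨b, hb, m, hm, rfl⟩ := Subgroup.mem_sup_of_normal_left.1
      (show a ∈ (A ⊓ B) ⊔ M from hsup ▸ Subgroup.mem_top a)
    have hmA : m ∈ A := (A.mul_mem_cancel_left hb.1).1 ha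
    exact B.mul_mem hb.2 (hAB ▸ (⟨hmA, hm⟩ : m ∈ A ⊓ M) : m ∈ B ⊓ M).1
  have h1 : {K : Subgroup G | K.Normal}.ncard ≤ (Set.Iic M).ncard + 1 := by
    have hsub : {K : Subgroup G | K.Normal} ⊆ insert ⊥ {K : Subgroup G | K.Normal ∧ K ≠ ⊥} := by
      intro K hK
      by_cases h0 : K = ⊥
      · exact Or.inl h0
      · exact Or.inr ⟨hK, h0⟩
    refine (Set.ncard_le_ncard hsub).trans ((Set.ncard_insert_le _ _).trans ?_)
    refine Nat.add_le_add_right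
      (Set.ncard_le_ncard_of_injOn (fun K : Subgroup G => K ⊓ M) (fun K _ => ?_) ?_) 1
    · exact Set.mem_Iic.2 inf_le_right
    · rintro A ⟨hA, hA0⟩ B ⟨hB, hB0⟩ hAB
      exact le_antisymm (hle A B hA hB hA0 hB0 hAB) (hle B A hB hA hB0 hA0 hAB.symm)
  have h2 : (Set.Iic M).ncard ≤ {K : Subgroup G | ¬ K.Normal}.ncard := by
    obtain ⟨g, hg⟩ := not_forall.1 (mt Subgroup.normal_iff_map_conj_eq.2 hMn)
    change M.map (MulAut.conj g).toMonoidHom ≠ M at hg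
    have hnot : M.map (MulAut.conj g).toMonoidHom ∉ Set.Iic M \ {⊥} := by
      rintro ⟨hle, -⟩
      refine hg (Subgroup.eq_of_le_of_card_ge hle ?_)
      rw [Subgroup.card_map_of_injective (MulAut.conj g).injective]
    have hsub : insert (M.map (MulAut.conj g).toMonoidHom) (Set.Iic M \ {⊥}) ⊆
        {K : Subgroup G | ¬ K.Normal} := by
      rintro K (rfl | ⟨hK, h0⟩)
      · exact fun hn' => hg
          (eq_of_orbitRel_of_normal (Setoid.symm' _ ((orbitRel_iff _ _).2 ⟨g, rfl⟩)) hn').symm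
      · exact fun hn' => h0 (hcore K hn' hK)
    refine le_trans (le_of_eq ?_) (Set.ncard_le_ncard hsub)
    rw [Set.ncard_insert_of_notMem hnot,
      Set.ncard_sdiff_singleton_add_one (Set.mem_Iic.2 bot_le)]
  have h3 : 1 < (Set.Iic M).ncard := by
    refine (Set.one_lt_ncard_iff (Set.toFinite _)).2
      ⟨⊥, M, Set.mem_Iic.2 bot_le, Set.mem_Iic.2 le_rfl, ?_⟩
    rintro rfl
    exact hMn inferInstance
  have h4 := h G (IsSection.refl G)
  omega

/-! ### Permuting cyclic subgroups in `p`-groups -/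

/-- Any two cyclic subgroups of `G` permute, in element form: every product `y * x` can be rewritten
as a power of `x` times a power of `y`. -/
def CyclicPermute (G : Type*) [Group G] : Prop :=
  ∀ x y : G, ∃ i j : ℤ, y * x = x ^ i * y ^ j

theorem exists_mul_eq_of_mem_sup {G : Type*} [Group G] {X Y : Subgroup G}
    (h : ∀ x ∈ X, ∀ y ∈ Y, ∃ x' ∈ X, ∃ y' ∈ Y, y * x = x' * y') {g : G} (hg : g ∈ X ⊔ Y) :
    ∃ x ∈ X, ∃ y ∈ Y, x * y = g := by
  let S : Subgroup G :=
    { carrier := {g | ∃ x ∈ X, ∃ y ∈ Y, x * y = g}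
      one_mem' := ⟨1, X.one_mem, 1, Y.one_mem, one_mul 1⟩
      mul_mem' := by
        rintro _ _ ⟨a, ha, b, hb, rfl⟩ ⟨c, hc, d, hd, rfl⟩
        obtain ⟨x, hx, y, hy, e⟩ := h c hc b hb
        refine ⟨a * x, X.mul_mem ha hx, y * d, Y.mul_mem hy hd, ?_⟩
        calc a * x * (y * d) = a * (x * y) * d := by group
          _ = a * b * (c * d) := by rw [← e]; group
      inv_mem' := by
        rintro _ ⟨a, ha, b, hb, rfl⟩
        obtain ⟨x, hx, y, hy, e⟩ := h a⁻¹ (X.inv_mem ha) b⁻¹ (Y.inv_mem hb)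
        exact ⟨x, hx, y, hy, by rw [← e, mul_inv_rev]⟩ }
  have hXY : X ⊔ Y ≤ S :=
    sup_le (fun x hx => ⟨x, hx, 1, Y.one_mem, mul_one x⟩)
      (fun y hy => ⟨1, X.one_mem, y, hy, one_mul y⟩)
  exact hXY hg

theorem CyclicPermute.exists_mul_eq {G : Type*} [Group G] (h : CyclicPermute G) {X Y : Subgroup G}
    {g : G} (hg : g ∈ X ⊔ Y) : ∃ x ∈ X, ∃ y ∈ Y, x * y = g :=
  exists_mul_eq_of_mem_sup (fun x hx y hy =>
    let ⟨i, j, e⟩ := h x y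
    ⟨x ^ i, X.zpow_mem hx i, y ^ j, Y.zpow_mem hy j, e⟩) hg

theorem mul_comm_of_card_eq_prime_pow {p n : ℕ} [Fact p.Prime] {K : Type*} [Group K] (hn : n ≤ 2)
    (h : Nat.card K = p ^ n) (u v : K) : u * v = v * u := by
  interval_cases n
  · have : Subsingleton K := (Nat.card_eq_one_iff_unique.1 (by simpa using h)).1
    exact Subsingleton.elim _ _
  · have : IsCyclic K := isCyclic_of_prime_card (p := p) (by simpa using h)
    exact (IsCyclic.commGroup (α := K)).mul_comm u v
  · exact (IsPGroup.isMulCommutative_of_card_eq_prime_sq h).is_comm.comm u v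

/-- In a `p`-group with permuting cyclic subgroups, two elements of order dividing `p` generate a
group of order dividing `p ^ 2`. -/
theorem CyclicPermute.commute {p : ℕ} [Fact p.Prime] {G : Type*} [Group G] [Finite G]
    (h : CyclicPermute G) (hG : IsPGroup p G) {a b : G} (ha : a ^ p = 1) (hb : b ^ p = 1) :
    Commute a b := by
  have hp : p.Prime := Fact.out
  set K := Subgroup.zpowers a ⊔ Subgroup.zpowers b with hK
  have hcard : Nat.card K ≤ p ^ 2 := by
    have h1 : (K : Set G) ⊆ (Subgroup.zpowers a : Set G) * (Subgroup.zpowers b : Set G) :=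
      fun g hg => by
        obtain ⟨x, hx, y, hy, e⟩ := h.exists_mul_eq hg
        exact ⟨x, hx, y, hy, e⟩
    have h2 : ∀ c : G, c ^ p = 1 → Nat.card (Subgroup.zpowers c) ≤ p := fun c hc => by
      rw [Nat.card_zpowers]
      exact orderOf_le_of_pow_eq_one hp.pos hc
    calc Nat.card K = (K : Set G).ncard := rfl
      _ ≤ ((Subgroup.zpowers a : Set G) * (Subgroup.zpowers b : Set G)).ncard :=
        Set.ncard_le_ncard h1 (Set.toFinite _)
      _ ≤ Nat.card (Subgroup.zpowers a) * Nat.card (Subgroup.zpowers b) := Set.natCard_mul_le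
      _ ≤ p * p := Nat.mul_le_mul (h2 a ha) (h2 b hb)
      _ = p ^ 2 := (sq p).symm
  have haK : a ∈ K := Subgroup.mem_sup_left (Subgroup.mem_zpowers a)
  have hbK : b ∈ K := Subgroup.mem_sup_right (Subgroup.mem_zpowers b)
  suffices hc : ∀ u v : K, u * v = v * u from congrArg Subtype.val (hc ⟨a, haK⟩ ⟨b, hbK⟩)
  obtain ⟨n, hn⟩ := IsPGroup.iff_card.1 (hG.to_subgroup K)
  exact mul_comm_of_card_eq_prime_pow ((Nat.pow_le_pow_iff_right hp.one_lt).1 (hn ▸ hcard)) hn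

theorem exists_mem_center_of_normal {p : ℕ} [Fact p.Prime] {G : Type*} [Group G] [Finite G]
    (hG : IsPGroup p G) {W : Subgroup G} (hW : W.Normal) (h : W ≠ ⊥) :
    ∃ z ∈ W, z ∈ Subgroup.center G ∧ z ≠ 1 := by
  have hd : p ∣ Nat.card W := (hG.to_subgroup W).card_eq_or_dvd.resolve_left fun h1 =>
    h (W.card_eq_one.1 h1)
  obtain ⟨z, hz, hne⟩ := (hG.of_equiv ConjAct.toConjAct)
    |>.exists_fixed_point_of_prime_dvd_card_of_fixed_point W hd (a := 1)
      (fun g => smul_one g)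
  refine ⟨z, z.2, Subgroup.mem_center_iff.2 fun g => ?_, fun h1 => hne (Subtype.ext h1.symm)⟩
  have := congrArg Subtype.val (hz (ConjAct.toConjAct g))
  rw [ConjAct.Subgroup.val_conj_smul, ConjAct.toConjAct_smul] at this
  exact mul_inv_eq_iff_eq_mul.1 this

/-- A proper subgroup can be enlarged so as to contain `x ^ p`, and stay proper: a maximal subgroup of
a `p`-group contains all `p`-th powers. -/
theorem exists_ne_top_pow_mem {p : ℕ} [Fact p.Prime] {G : Type*} [Group G] [Finite G]
    (hG : IsPGroup p G) {H : Subgroup G} (hH : H ≠ ⊤) (x : G) :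
    ∃ M : Subgroup G, M ≠ ⊤ ∧ H ≤ M ∧ x ^ p ∈ M := by
  obtain ⟨M, hM, hHM⟩ := (eq_top_or_exists_le_coatom H).resolve_left hH
  have := hG.isNilpotent
  have hMn : M.Normal := Subgroup.NormalizerCondition.normal_of_coatom M
    Group.normalizerCondition_of_isNilpotent hM
  refine ⟨M, hM.1, hHM, ?_⟩
  by_contra hx
  have htop : M ⊔ Subgroup.zpowers (x ^ p) = ⊤ := hM.2 _ <| lt_of_le_of_ne le_sup_left fun h =>
    hx (h ▸ Subgroup.mem_sup_right (Subgroup.mem_zpowers _))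
  obtain ⟨m, hm, _, ⟨k, rfl⟩, e⟩ := Subgroup.mem_sup_of_normal_left.1
    (show x ∈ M ⊔ Subgroup.zpowers (x ^ p) from htop ▸ Subgroup.mem_top x)
  obtain ⟨n, hn⟩ := IsPGroup.iff_orderOf.1 hG x
  -- `1 - p * k` is prime to the order of `x`, so the power `x ^ (1 - p * k) ∈ M` generates `⟨x⟩`.
  have hm' : x ^ (1 - p * k : ℤ) ∈ M := by
    have : x ^ (1 - p * k : ℤ) = m := by
      rw [zpow_sub, zpow_one, zpow_mul, zpow_natCast]
      exact (eq_mul_inv_of_mul_eq e).symm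
    exact this ▸ hm
  have hcop : IsCoprime (1 - p * k : ℤ) ((p : ℤ) ^ n) :=
    IsCoprime.pow_right ⟨1, k, by ring⟩
  obtain ⟨u, v, huv⟩ := hcop
  have hxM : x ∈ M := by
    have h1 : x ^ ((p : ℤ) ^ n) = 1 := by
      have := pow_orderOf_eq_one x
      rw [hn] at this
      exact_mod_cast this
    have h2 : x = (x ^ (1 - p * k : ℤ)) ^ u := by
      rw [← zpow_mul]
      conv_lhs => rw [← zpow_one x, ← huv, zpow_add, mul_comm v, zpow_mul x ((p : ℤ) ^ n), h1,
        one_zpow, mul_one, mul_comm u]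
    exact h2 ▸ M.zpow_mem hm' u
  exact hx (M.pow_mem hxM p)

/-- The subgroup of order `p` of a cyclic group `⟨x⟩` of order `p ^ n` with `n ≥ 2`. -/
theorem exists_generator_of_socle {p : ℕ} [Fact p.Prime] {G : Type*} [Group G]
    (hG : IsPGroup p G) {x : G} (hx : x ^ p ≠ 1) :
    ∃ x₀ ∈ Subgroup.zpowers (x ^ p), x₀ ^ p = 1 ∧ x₀ ≠ 1 ∧
      ∀ g ∈ Subgroup.zpowers x, g ^ p = 1 → g ∈ Subgroup.zpowers x₀ := by
  have hp : p.Prime := Fact.out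
  obtain ⟨n, hn⟩ := IsPGroup.iff_orderOf.1 hG x
  have hn2 : 2 ≤ n := by
    by_contra hlt
    refine hx (orderOf_dvd_iff_pow_eq_one.1 ?_)
    rw [hn]
    exact (pow_dvd_pow p (by omega : n ≤ 1)).trans (by rw [pow_one])
  obtain ⟨m, rfl⟩ := Nat.exists_eq_add_of_le' hn2
  refine ⟨(x ^ p) ^ p ^ m, Subgroup.pow_mem _ (Subgroup.mem_zpowers _) _, ?_, ?_, ?_⟩
  · rw [← pow_mul, ← pow_mul, ← orderOf_dvd_iff_pow_eq_one, hn]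
    exact dvd_of_eq (by ring)
  · rw [← pow_mul, Ne, ← orderOf_dvd_iff_pow_eq_one, hn, ← pow_succ', Nat.pow_dvd_pow_iff_le_right
      hp.one_lt]
    omega
  · rintro _ ⟨k, rfl⟩ hk
    have h1 : ((p ^ (m + 2) : ℕ) : ℤ) ∣ k * p := by
      rw [← hn, orderOf_dvd_iff_zpow_eq_one, zpow_mul, zpow_natCast]
      exact hk
    have h2 : (p : ℤ) ^ (m + 1) ∣ k := by
      have h0 : (p : ℤ) ≠ 0 := by exact_mod_cast hp.ne_zero
      refine Int.dvd_of_mul_dvd_mul_right h0 ?_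
      push_cast at h1
      rwa [← pow_succ]
    obtain ⟨c, rfl⟩ := h2
    refine ⟨c, ?_⟩
    change ((x ^ p) ^ p ^ m) ^ c = x ^ ((p : ℤ) ^ (m + 1) * c)
    rw [zpow_mul, ← pow_mul, ← pow_succ']
    congr 1
    exact_mod_cast (zpow_natCast x (p ^ (m + 1))).symm

theorem zpowers_ne_top_of_not_commute {G : Type*} [Group G] {x y : G} (hxy : ¬ Commute x y) :
    Subgroup.zpowers y ≠ ⊤ := by
  intro h
  obtain ⟨k, hk⟩ : x ∈ Subgroup.zpowers y := h ▸ Subgroup.mem_top x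
  exact hxy (hk ▸ (Commute.refl y).zpow_left k)

/-- If `⟨x⟩` has order greater than `p`, its subgroup `⟨x₀⟩` of order `p` lies in a proper subgroup
together with `y`. If `y ^ p = 1` this makes `x₀` central; otherwise `⟨x₀, y₀⟩` is normal, where
`⟨y₀⟩` is the subgroup of order `p` of `⟨y⟩`, and meets the centre. Either way `⟨x⟩⟨y⟩` contains
a central element of order `p`. -/
theorem pow_eq_one_of_forall_center {p : ℕ} [Fact p.Prime] {G : Type*} [Group G] [Finite G]
    {x y : G} (hG : IsPGroup p G)
    (hgen : ∀ H : Subgroup G, x ∈ H → y ∈ H → H = ⊤)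
    (hsub : ∀ H : Subgroup G, H ≠ ⊤ → CyclicPermute H) (hxy : ¬ Commute x y)
    (hz : ∀ z ∈ Subgroup.center G, z ^ p = 1 → ∀ i j : ℤ, z = x ^ i * y ^ j → z = 1) :
    x ^ p = 1 := by
  by_contra hx
  have hcomm : ∀ H : Subgroup G, H ≠ ⊤ → ∀ a ∈ H, ∀ b ∈ H, a ^ p = 1 → b ^ p = 1 →
      Commute a b := fun H hH a ha b hb hap hbp =>
    congrArg Subtype.val ((hsub H hH).commute (hG.to_subgroup H) (a := ⟨a, ha⟩) (b := ⟨b, hb⟩)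
      (Subtype.ext hap) (Subtype.ext hbp)).eq
  obtain ⟨M, hM, hyM, hxM⟩ := exists_ne_top_pow_mem hG (zpowers_ne_top_of_not_commute hxy) x
  rw [Subgroup.zpowers_le] at hyM
  obtain ⟨x₀, hx₀, hx₀p, hx₀1, hx₀s⟩ := exists_generator_of_socle hG hx
  have hx₀M : x₀ ∈ M := (Subgroup.zpowers_le.2 hxM) hx₀
  obtain ⟨a, ha⟩ : x₀ ∈ Subgroup.zpowers x :=
    Subgroup.zpowers_le.2 (Subgroup.pow_mem _ (Subgroup.mem_zpowers x) p) hx₀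
  change x ^ a = x₀ at ha
  have hxx₀ : Commute x x₀ := ha ▸ (Commute.refl x).zpow_right a
  by_cases hy : y ^ p = 1
  · have hyx₀ : Commute y x₀ := hcomm M hM y hyM x₀ hx₀M hy hx₀p
    have htop := hgen (Subgroup.centralizer {x₀})
      (Subgroup.mem_centralizer_singleton_iff.2 hxx₀.eq)
      (Subgroup.mem_centralizer_singleton_iff.2 hyx₀.eq)
    refine hx₀1 (hz x₀ (Subgroup.mem_center_iff.2 fun g => ?_) hx₀p a 0 (by simp [ha]))
    exact Subgroup.mem_centralizer_singleton_iff.1 (htop ▸ Subgroup.mem_top g)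
  · obtain ⟨M', hM', hxM', hyM'⟩ :=
      exists_ne_top_pow_mem hG (zpowers_ne_top_of_not_commute fun h => hxy h.symm) y
    rw [Subgroup.zpowers_le] at hxM'
    obtain ⟨y₀, hy₀, hy₀p, hy₀1, hy₀s⟩ := exists_generator_of_socle hG hy
    have hy₀M' : y₀ ∈ M' := (Subgroup.zpowers_le.2 hyM') hy₀
    obtain ⟨b, hb⟩ : y₀ ∈ Subgroup.zpowers y :=
      Subgroup.zpowers_le.2 (Subgroup.pow_mem _ (Subgroup.mem_zpowers y) p) hy₀
    change y ^ b = y₀ at hb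
    have hyy₀ : Commute y y₀ := hb ▸ (Commute.refl y).zpow_right b
    have hy₀M : y₀ ∈ M := hb ▸ M.zpow_mem hyM b
    have h₀ : Commute x₀ y₀ := hcomm M hM x₀ hx₀M y₀ hy₀M hx₀p hy₀p
    -- For a suitable `i`, the element `u₀ ^ (-i) * (v * u₀ * v⁻¹)` is a power of `v`; its order
    -- divides `p` because its two factors commute, both lying in the proper subgroup `N`.
    have hconj : ∀ (N : Subgroup G) (u₀ v v₀ : G), N ≠ ⊤ → u₀ ∈ N → v ∈ N → u₀ ^ p = 1 →
        (∀ g ∈ Subgroup.zpowers v, g ^ p = 1 → g ∈ Subgroup.zpowers v₀) →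
        v * u₀ * v⁻¹ ∈ Subgroup.closure {u₀, v₀} := by
      intro N u₀ v v₀ hN hu hv hu₀ hs
      obtain ⟨i, j, e⟩ := hsub N hN ⟨u₀, hu⟩ ⟨v, hv⟩
      replace e : v * u₀ = u₀ ^ i * v ^ j := congrArg Subtype.val e
      have hvp : (v * u₀ * v⁻¹) ^ p = 1 := by rw [conj_pow, hu₀, mul_one, mul_inv_cancel]
      have hup : (u₀ ^ (-i)) ^ p = 1 := by
        rw [← zpow_natCast, ← zpow_mul, mul_comm, zpow_mul, zpow_natCast, hu₀, one_zpow]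
      have hc := hcomm N hN _ (N.zpow_mem hu (-i)) _
        (N.mul_mem (N.mul_mem hv hu) (N.inv_mem hv)) hup hvp
      have hve : u₀ ^ (-i) * (v * u₀ * v⁻¹) = v ^ (j - 1) := by
        rw [e, zpow_neg, zpow_sub, zpow_one]
        group
      have hmem : v ^ (j - 1) ∈ Subgroup.zpowers v₀ := by
        refine hs _ ⟨j - 1, rfl⟩ ?_
        rw [← hve, hc.mul_pow, hup, hvp, one_mul]
      rw [← hve] at hmem
      have h1 : Subgroup.zpowers v₀ ≤ Subgroup.closure {u₀, v₀} :=
        Subgroup.zpowers_le.2 (Subgroup.subset_closure (by simp))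
      have h2 : u₀ ∈ Subgroup.closure {u₀, v₀} := Subgroup.subset_closure (by simp)
      exact (Subgroup.mul_mem_cancel_left _ (Subgroup.zpow_mem _ h2 _)).1 (h1 hmem)
    have hx₀W : x₀ ∈ Subgroup.closure {x₀, y₀} := Subgroup.subset_closure (by simp)
    have hy₀W : y₀ ∈ Subgroup.closure {x₀, y₀} := Subgroup.subset_closure (by simp)
    have hnorm : (Subgroup.closure {x₀, y₀}).Normal := by
      rw [← Subgroup.normalizer_eq_top_iff]
      have hle : ∀ g : G, g * x₀ * g⁻¹ ∈ Subgroup.closure {x₀, y₀} →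
          g * y₀ * g⁻¹ ∈ Subgroup.closure {x₀, y₀} →
          g ∈ Subgroup.normalizer (Subgroup.closure {x₀, y₀} : Set G) := by
        intro g h1 h2
        rw [Subgroup.mem_normalizer_iff_map_conj_eq]
        refine Subgroup.eq_of_le_of_card_ge ?_ ?_
        · rw [MonoidHom.map_closure, Subgroup.closure_le]
          rintro _ ⟨w, rfl | rfl, rfl⟩
          · exact h1
          · exact h2
        · exact (Subgroup.card_map_of_injective (MulAut.conj g).injective).ge
      refine hgen _ (hle x ?_ ?_) (hle y ?_ ?_)
      · rwa [hxx₀.eq, mul_inv_cancel_right]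
      · rw [Set.pair_comm]
        exact hconj M' y₀ x x₀ hM' hy₀M' hxM' hy₀p hx₀s
      · exact hconj M x₀ y y₀ hM hx₀M hyM hx₀p hy₀s
      · rwa [hyy₀.eq, mul_inv_cancel_right]
    obtain ⟨z, hzW, hzc, hz1⟩ := exists_mem_center_of_normal hG hnorm fun h =>
      hx₀1 ((Subgroup.eq_bot_iff_forall _).1 h x₀ hx₀W)
    rw [Set.insert_eq, Subgroup.closure_union, ← Subgroup.zpowers_eq_closure,
      ← Subgroup.zpowers_eq_closure] at hzW
    have hperm : ∀ u ∈ Subgroup.zpowers x₀, ∀ v ∈ Subgroup.zpowers y₀,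
        ∃ u' ∈ Subgroup.zpowers x₀, ∃ v' ∈ Subgroup.zpowers y₀, v * u = u' * v' := by
      rintro _ ⟨s, rfl⟩ _ ⟨t, rfl⟩
      exact ⟨_, ⟨s, rfl⟩, _, ⟨t, rfl⟩, (h₀.zpow_zpow s t).eq.symm⟩
    obtain ⟨_, ⟨s, rfl⟩, _, ⟨t, rfl⟩, e⟩ := exists_mul_eq_of_mem_sup hperm hzW
    change x₀ ^ s * y₀ ^ t = z at e
    refine hz1 (hz z hzc ?_ (a * s) (b * t) ?_)
    · rw [← e, (h₀.zpow_zpow s t).mul_pow, ← zpow_natCast, ← zpow_natCast, ← zpow_mul, ← zpow_mul,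
        mul_comm s, mul_comm t, zpow_mul, zpow_mul, zpow_natCast, zpow_natCast, hx₀p, hy₀p,
        one_zpow, one_zpow, one_mul]
    · rw [← e, zpow_mul, zpow_mul, ha, hb]

/-! ### Nonabelian groups of order `p ^ 3` generated by elements of order `p`

Here `x ^ p = y ^ p = c ^ p = 1`, `c` is central and different from `1`, `y * x = x * y * c`, and
`x`, `y` generate the group. Its elements are the products `x ^ i * y ^ j * c ^ k`.
-/

section OrderCubed

variable {p : ℕ} [hp : Fact p.Prime] {G : Type*} [Group G] {x y c : G}

theorem mul_mul_mul_normalForm (hc : c ∈ Subgroup.center G) (h : y * x = x * y * c)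
    (i j k i' j' k' : ℤ) :
    x ^ i * y ^ j * c ^ k * (x ^ i' * y ^ j' * c ^ k') =
      x ^ (i + i') * y ^ (j + j') * c ^ (k + k' + i' * j) := by
  have hcg : ∀ g : G, Commute c g := fun g => (Subgroup.mem_center_iff.1 hc g).symm
  have h1 : y * x ^ i' * y⁻¹ = x ^ i' * c ^ i' := by
    rw [← (hcg x).symm.mul_zpow, ← conj_zpow, h]
    congr 1
    rw [mul_assoc x y c, ← (hcg y).eq, ← mul_assoc, mul_inv_cancel_right]
  have h2 : (x ^ i')⁻¹ * y * x ^ i' = y * c ^ i' := by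
    rw [mul_assoc, mul_inv_eq_iff_eq_mul.1 h1, mul_assoc, ((hcg y).zpow_left i').eq,
      inv_mul_cancel_left]
  have h3 : y ^ j * x ^ i' = x ^ i' * (y ^ j * c ^ (i' * j)) := by
    rw [← inv_mul_eq_iff_eq_mul, zpow_mul, ← ((hcg y).symm.zpow_right i').mul_zpow, ← h2,
      ← mul_assoc]
    simpa using (conj_zpow (a := (x ^ i')⁻¹) (b := y) (i := j)).symm
  have hck : ∀ (k : ℤ) (g : G), c ^ k * g = g * c ^ k := fun k g => ((hcg g).zpow_left k).eq
  calc x ^ i * y ^ j * c ^ k * (x ^ i' * y ^ j' * c ^ k')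
      = x ^ i * (y ^ j * (c ^ k * (x ^ i' * (y ^ j' * c ^ k')))) := by simp only [mul_assoc]
    _ = x ^ i * ((y ^ j * x ^ i') * (y ^ j' * (c ^ k * c ^ k'))) := by
        rw [hck k (x ^ i' * _), mul_assoc, mul_assoc, mul_assoc, ← hck k]
    _ = x ^ (i + i') * y ^ (j + j') * c ^ (k + k' + i' * j) := by
        rw [h3, mul_assoc (x ^ i'), mul_assoc (y ^ j), hck (i' * j), zpow_add x, zpow_add y,
          zpow_add c, zpow_add c]
        simp only [mul_assoc]

theorem exists_normalForm (hc : c ∈ Subgroup.center G) (h : y * x = x * y * c)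
    (hgen : ∀ H : Subgroup G, x ∈ H → y ∈ H → H = ⊤) (g : G) :
    ∃ i j k : ℤ, g = x ^ i * y ^ j * c ^ k := by
  let S : Subgroup G :=
    { carrier := {g | ∃ i j k : ℤ, g = x ^ i * y ^ j * c ^ k}
      one_mem' := ⟨0, 0, 0, by simp⟩
      mul_mem' := by
        rintro _ _ ⟨i, j, k, rfl⟩ ⟨i', j', k', rfl⟩
        exact ⟨_, _, _, mul_mul_mul_normalForm hc h ..⟩
      inv_mem' := by
        rintro _ ⟨i, j, k, rfl⟩
        refine ⟨-i, -j, -k + i * j, ?_⟩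
        rw [inv_eq_iff_mul_eq_one, mul_mul_mul_normalForm hc h]
        simp only [add_neg_cancel, zpow_zero, one_mul]
        ring_nf
        exact zpow_zero c }
  have : S = ⊤ := hgen S ⟨1, 0, 0, by simp⟩ ⟨0, 1, 0, by simp⟩
  exact (this ▸ Subgroup.mem_top g : g ∈ S)

theorem mem_of_zpow_mem {K : Subgroup G} {w : G} (hw : w ^ p = 1) {m : ℤ} (hm : ¬ (p : ℤ) ∣ m)
    (h : w ^ m ∈ K) : w ∈ K := by
  obtain ⟨u, v, huv⟩ := ((Nat.prime_iff_prime_int.1 hp.out).coprime_iff_not_dvd).2 hm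
  have : w = (w ^ m) ^ v := by
    conv_lhs => rw [← zpow_one w, ← huv, zpow_add, mul_comm u, zpow_mul w p, zpow_natCast, hw,
      one_zpow, one_mul, mul_comm v, zpow_mul]
  exact this ▸ K.zpow_mem h v

/-- Only the trivial normal subgroup misses `c`: commuting an element with `x` or `y` gives a power
of `c`, which is nontrivial unless the element is itself a power of `c`. -/
theorem mem_of_normal (hc : c ∈ Subgroup.center G) (h : y * x = x * y * c)
    (hgen : ∀ H : Subgroup G, x ∈ H → y ∈ H → H = ⊤)
    (hx : x ^ p = 1) (hy : y ^ p = 1) (hcp : c ^ p = 1)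
    {K : Subgroup G} (hK : K.Normal) (hne : K ≠ ⊥) : c ∈ K := by
  obtain ⟨g, hg1⟩ := K.ne_bot_iff_exists_ne_one.1 hne
  obtain ⟨i, j, k, e⟩ := exists_normalForm hc h hgen (g : G)
  have hcomm : ∀ (v : G) (m : ℤ), (g : G) * v = v * g * c ^ m → c ^ m ∈ K := by
    intro v m hv
    have : c ^ m = (g : G)⁻¹ * (v⁻¹ * g * v⁻¹⁻¹) := by
      rw [inv_inv, mul_assoc v⁻¹, hv]
      group
    exact this ▸ K.mul_mem (K.inv_mem g.2) (hK.conj_mem _ g.2 _)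
  by_cases hj : (p : ℤ) ∣ j
  · by_cases hi : (p : ℤ) ∣ i
    · have hgc : (g : G) = c ^ k := by
        obtain ⟨i', rfl⟩ := hi
        obtain ⟨j', rfl⟩ := hj
        rw [e, zpow_mul, zpow_mul, zpow_natCast, zpow_natCast, hx, hy]
        simp
      refine mem_of_zpow_mem hcp (fun hk => hg1 (Subtype.ext ?_)) (hgc ▸ g.2)
      obtain ⟨k', rfl⟩ := hk
      rw [hgc, zpow_mul, zpow_natCast, hcp, one_zpow]
      rfl
    · refine mem_of_zpow_mem hcp (fun hi' => hi ((dvd_neg).1 hi')) (hcomm y (-i) ?_)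
      have e1 := mul_mul_mul_normalForm hc h i j k 0 1 0
      have e2 := mul_mul_mul_normalForm hc h 0 1 0 i j k
      simp only [zpow_zero, zpow_one, one_mul, mul_one, ← e] at e1 e2
      rw [e1, e2, mul_assoc _ (c ^ _) (c ^ _), ← zpow_add, add_comm 0 i, add_comm 1 j]
      congr 2
      ring
  · refine mem_of_zpow_mem hcp hj (hcomm x j ?_)
    have e1 := mul_mul_mul_normalForm hc h i j k 1 0 0
    have e2 := mul_mul_mul_normalForm hc h 1 0 0 i j k
    simp only [zpow_zero, zpow_one, one_mul, mul_one, ← e] at e1 e2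
    rw [e1, e2, mul_assoc _ (c ^ _) (c ^ _), ← zpow_add, add_comm 1 i, add_comm 0 j]
    congr 2
    ring

/-- A subgroup containing `c` is determined by the lattice of exponents of `x` and `y` that occur
in it. -/
theorem exists_exponentLattice (hc : c ∈ Subgroup.center G) (h : y * x = x * y * c)
    {K : Subgroup G} (hK : c ∈ K) :
    ∃ Λ : AddSubgroup (ℤ × ℤ), ∀ i j k : ℤ, x ^ i * y ^ j * c ^ k ∈ K ↔ (i, j) ∈ Λ := by
  have hmem : ∀ {g : G} (k : ℤ), g * c ^ k ∈ K ↔ g ∈ K := fun k =>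
    K.mul_mem_cancel_right (K.zpow_mem hK k)
  let Λ : AddSubgroup (ℤ × ℤ) :=
    { carrier := {q | x ^ q.1 * y ^ q.2 ∈ K}
      zero_mem' := by simp
      add_mem' := by
        rintro ⟨i, j⟩ ⟨i', j'⟩ h1 h2
        have := mul_mul_mul_normalForm hc h i j 0 i' j' 0
        rw [zpow_zero, mul_one, mul_one] at this
        exact (hmem _).1 (this ▸ K.mul_mem h1 h2)
      neg_mem' := by
        rintro ⟨i, j⟩ h1
        have := mul_mul_mul_normalForm hc h i j 0 (-i) (-j) 0
        rw [zpow_zero, mul_one, mul_one, add_neg_cancel, add_neg_cancel, zpow_zero, zpow_zero,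
          one_mul, one_mul] at this
        exact (K.mul_mem_cancel_left h1).1 (this ▸ K.zpow_mem hK _) }
  exact ⟨Λ, fun i j k => hmem k⟩

/-- The normal subgroups: besides `⊥`, the preimages of the subgroups of the elementary abelian
group `G ⧸ ⟨c⟩` of order `p ^ 2`. -/
theorem eq_of_normal (hc : c ∈ Subgroup.center G) (h : y * x = x * y * c)
    (hgen : ∀ H : Subgroup G, x ∈ H → y ∈ H → H = ⊤)
    (hx : x ^ p = 1) (hy : y ^ p = 1) (hcp : c ^ p = 1)
    {K : Subgroup G} (hK : K.Normal) :
    K = ⊥ ∨ K = ⊤ ∨ K = Subgroup.zpowers c ∨ K = Subgroup.closure {x, c} ∨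
      ∃ t ∈ Finset.range p, K = Subgroup.closure {x ^ t * y, c} := by
  refine or_iff_not_imp_left.2 fun hne => ?_
  have hcK := mem_of_normal hc h hgen hx hy hcp hK hne
  have hlat : ∀ {A : Subgroup G} {Λ : AddSubgroup (ℤ × ℤ)},
      (∀ i j k : ℤ, x ^ i * y ^ j * c ^ k ∈ A ↔ (i, j) ∈ Λ) →
      (∀ s : ℤ, ((p : ℤ) * s, (0 : ℤ)) ∈ Λ) ∧ ∀ s : ℤ, ((0 : ℤ), (p : ℤ) * s) ∈ Λ := by
    intro A Λ hΛ
    refine ⟨fun s => (hΛ _ _ 0).1 ?_, fun s => (hΛ _ _ 0).1 ?_⟩ <;>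
    simp [zpow_mul, hx, hy]
  have hprime := Nat.prime_iff_prime_int.1 hp.out
  obtain ⟨Λ, hΛ⟩ := exists_exponentLattice hc h hcK
  obtain ⟨hpx, hpy⟩ := hlat hΛ
  have hx1 : ∀ i, ¬ (p : ℤ) ∣ i → (i, (0 : ℤ)) ∈ Λ → ((1 : ℤ), (0 : ℤ)) ∈ Λ := by
    intro i hi hiΛ
    obtain ⟨u, v, huv⟩ := hprime.coprime_iff_not_dvd.2 hi
    have := Λ.add_mem (hpx u) (Λ.zsmul_mem hiΛ v)
    rwa [Prod.smul_mk, Prod.mk_add_mk, smul_zero, add_zero, smul_eq_mul, mul_comm _ u, huv] at this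
  have hxK : ((1 : ℤ), (0 : ℤ)) ∈ Λ ↔ x ∈ K := by simpa using (hΛ 1 0 0).symm
  have hyK : ((0 : ℤ), (1 : ℤ)) ∈ Λ ↔ y ∈ K := by simpa using (hΛ 0 1 0).symm
  by_cases hJ : ∃ i j, (i, j) ∈ Λ ∧ ¬ (p : ℤ) ∣ j
  · obtain ⟨i, j, hij, hj⟩ := hJ
    obtain ⟨u, v, huv⟩ := hprime.coprime_iff_not_dvd.2 hj
    have hp0 : (p : ℤ) ≠ 0 := hprime.ne_zero
    obtain ⟨t, ht⟩ := Int.eq_ofNat_of_zero_le (Int.emod_nonneg (v * i) hp0)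
    have htp : t < p := by
      have := Int.emod_lt_of_pos (v * i) (show (0 : ℤ) < p by exact_mod_cast hp.out.pos)
      rw [ht] at this
      exact_mod_cast this
    have htΛ : ((t : ℤ), (1 : ℤ)) ∈ Λ := by
      have := Λ.add_mem (Λ.add_mem (Λ.zsmul_mem hij v) (hpy u)) (hpx (-(v * i / p)))
      rw [Prod.smul_mk, Prod.mk_add_mk, Prod.mk_add_mk, smul_eq_mul, smul_eq_mul, add_zero,
        add_zero, add_comm (v * j), mul_comm _ u, huv, mul_neg, ← sub_eq_add_neg,
        ← Int.emod_def, ht] at this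
      exact this
    by_cases hmore : ∃ i, (i, (0 : ℤ)) ∈ Λ ∧ ¬ (p : ℤ) ∣ i
    · obtain ⟨i, hi, hpi⟩ := hmore
      have h1 := hx1 i hpi hi
      refine Or.inl (hgen K (hxK.1 h1) (hyK.1 ?_))
      simpa using Λ.sub_mem htΛ (Λ.zsmul_mem h1 t)
    · push Not at hmore
      refine Or.inr (Or.inr (Or.inr ⟨t, Finset.mem_range.2 htp, le_antisymm (fun g hg => ?_) ?_⟩))
      · have hcA : c ∈ Subgroup.closure {x ^ t * y, c} := Subgroup.subset_closure (by simp)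
        obtain ⟨Λ', hΛ'⟩ := exists_exponentLattice hc h hcA
        have htΛ' : ((t : ℤ), (1 : ℤ)) ∈ Λ' := (hΛ' _ _ 0).1 <| by
          simpa using Subgroup.subset_closure (show x ^ t * y ∈ ({x ^ t * y, c} : Set G) by simp)
        obtain ⟨i, j, k, rfl⟩ := exists_normalForm hc h hgen g
        have h1 := (hΛ _ _ _).1 hg
        obtain ⟨s, hs⟩ := hmore (i - j * t) (by simpa using Λ.sub_mem h1 (Λ.zsmul_mem htΛ j))
        refine (hΛ' _ _ _).2 ?_
        have := Λ'.add_mem ((hlat hΛ').1 s) (Λ'.zsmul_mem htΛ' j)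
        rw [← hs] at this
        simpa using this
      · rw [Subgroup.closure_le]
        rintro _ (rfl | rfl)
        · simpa using (hΛ t 1 0).2 htΛ
        · exact hcK
  · push Not at hJ
    have hy1 : ∀ {j}, (p : ℤ) ∣ j → y ^ j = 1 := by
      rintro _ ⟨s, rfl⟩
      rw [zpow_mul, zpow_natCast, hy, one_zpow]
    by_cases hI : ∃ i j, (i, j) ∈ Λ ∧ ¬ (p : ℤ) ∣ i
    · obtain ⟨i, j, hij, hi⟩ := hI
      obtain ⟨s, rfl⟩ := hJ i j hij
      have h1 := hxK.1 (hx1 i hi (by simpa using Λ.sub_mem hij (hpy s)))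
      refine Or.inr (Or.inr (Or.inl (le_antisymm (fun g hg => ?_) ?_)))
      · obtain ⟨i, j, k, rfl⟩ := exists_normalForm hc h hgen g
        rw [hy1 (hJ i j ((hΛ _ _ _).1 hg)), mul_one]
        exact Subgroup.mul_mem _ (Subgroup.zpow_mem _ (Subgroup.subset_closure (by simp)) _)
          (Subgroup.zpow_mem _ (Subgroup.subset_closure (by simp)) _)
      · rw [Subgroup.closure_le]
        rintro _ (rfl | rfl)
        · exact h1
        · exact hcK
    · push Not at hI
      refine Or.inr (Or.inl (le_antisymm (fun g hg => ?_) (Subgroup.zpowers_le.2 hcK)))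
      obtain ⟨i, j, k, rfl⟩ := exists_normalForm hc h hgen g
      have h1 := (hΛ _ _ _).1 hg
      obtain ⟨s, rfl⟩ := hI i j h1
      rw [hy1 (hJ _ j h1), zpow_mul, zpow_natCast, hx]
      exact ⟨k, by simp⟩

theorem ncard_normal_le (hc : c ∈ Subgroup.center G) (h : y * x = x * y * c)
    (hgen : ∀ H : Subgroup G, x ∈ H → y ∈ H → H = ⊤)
    (hx : x ^ p = 1) (hy : y ^ p = 1) (hcp : c ^ p = 1) :
    {K : Subgroup G | K.Normal}.ncard ≤ p + 4 := by
  classical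
  let T : Finset (Subgroup G) := insert ⊥ (insert ⊤ (insert (Subgroup.zpowers c)
    (insert (Subgroup.closure {x, c})
      ((Finset.range p).image fun t => Subgroup.closure {x ^ t * y, c}))))
  have hT : T.card ≤ p + 4 := by
    refine (Finset.card_insert_le _ _).trans (Nat.succ_le_succ ?_)
    refine (Finset.card_insert_le _ _).trans (Nat.succ_le_succ ?_)
    refine (Finset.card_insert_le _ _).trans (Nat.succ_le_succ ?_)
    refine (Finset.card_insert_le _ _).trans (Nat.succ_le_succ ?_)
    exact Finset.card_image_le.trans (Finset.card_range p).le
  refine le_trans ?_ hT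
  rw [← Set.ncard_coe_finset]
  refine Set.ncard_le_ncard (fun K hK => ?_) (Finset.finite_toSet T)
  simp only [T, Finset.coe_insert, Finset.coe_image, Set.mem_insert_iff, Set.mem_image]
  have := eq_of_normal hc h hgen hx hy hcp hK
  simpa [eq_comm] using this

theorem not_mem_zpowers_mul (hc : c ∈ Subgroup.center G) (hc1 : c ≠ 1) (hcp : c ^ p = 1) {w : G}
    (hw : w ^ p = 1) (hwc : w ∉ Subgroup.center G) (t : ℕ) : c ∉ Subgroup.zpowers (w * c ^ t) := by
  rintro ⟨m, hm⟩
  have hcw : Commute w (c ^ t) := Commute.pow_right (Subgroup.mem_center_iff.1 hc w) t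
  change (w * c ^ t) ^ m = c at hm
  have hdvd : (p : ℤ) ∣ m := by
    by_contra hdvd
    refine hwc (mem_of_zpow_mem hw hdvd ?_)
    rw [hcw.mul_zpow] at hm
    rw [← Subgroup.mul_mem_cancel_right _ (Subgroup.zpow_mem _ (Subgroup.pow_mem _ hc t) m), hm]
    exact hc
  obtain ⟨s, rfl⟩ := hdvd
  rw [zpow_mul, zpow_natCast, hcw.mul_pow, hw, ← pow_mul, mul_comm t, pow_mul, hcp, one_pow,
    one_mul, one_zpow] at hm
  exact hc1 hm.symm

/-- The cyclic subgroups generated by the elements `x * c ^ t` and `y * c ^ t` for `t < p` are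
distinct and, since they do not contain `c`, not normal. -/
theorem two_mul_le_ncard_not_normal [Finite G] (hc : c ∈ Subgroup.center G)
    (h : y * x = x * y * c) (hc1 : c ≠ 1) (hgen : ∀ H : Subgroup G, x ∈ H → y ∈ H → H = ⊤)
    (hx : x ^ p = 1) (hy : y ^ p = 1) (hcp : c ^ p = 1) :
    2 * p ≤ {K : Subgroup G | ¬ K.Normal}.ncard := by
  classical
  have hxy : ¬ Commute x y := fun hcomm => hc1 (by simpa [hcomm.eq] using h)
  have hxc : x ∉ Subgroup.center G := fun hh => hxy (Subgroup.mem_center_iff.1 hh y).symm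
  have hyc : y ∉ Subgroup.center G := fun hh => hxy (Subgroup.mem_center_iff.1 hh x)
  have hcg : ∀ g : G, Commute c g := fun g => (Subgroup.mem_center_iff.1 hc g).symm
  let T : G → Finset (Subgroup G) := fun w =>
    (Finset.range p).image fun t => Subgroup.zpowers (w * c ^ t)
  have hcard : ∀ w : G, w ^ p = 1 → w ∉ Subgroup.center G → (T w).card = p := by
    intro w hw hwc
    rw [Finset.card_image_of_injOn, Finset.card_range]
    intro s hs t ht hst
    by_contra hne
    have hmem : w * c ^ s ∈ Subgroup.zpowers (w * c ^ t) := by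
      have := Subgroup.mem_zpowers (w * c ^ s)
      rwa [show Subgroup.zpowers (w * c ^ s) = Subgroup.zpowers (w * c ^ t) from hst] at this
    have hmem' := Subgroup.mul_mem _ (Subgroup.inv_mem _ (Subgroup.mem_zpowers (w * c ^ t))) hmem
    have he : (w * c ^ t)⁻¹ * (w * c ^ s) = c ^ ((s : ℤ) - t) := by
      rw [zpow_sub, zpow_natCast, zpow_natCast, mul_inv_rev, mul_assoc, inv_mul_cancel_left]
      exact ((Commute.refl c).pow_pow s t).inv_right.eq.symm
    rw [he] at hmem'
    refine not_mem_zpowers_mul hc hc1 hcp hw hwc t (mem_of_zpow_mem hcp ?_ hmem')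
    have hs' := Finset.mem_range.1 (Finset.mem_coe.1 hs)
    have ht' := Finset.mem_range.1 (Finset.mem_coe.1 ht)
    intro hd
    have := Int.eq_zero_of_abs_lt_dvd hd (by rw [abs_lt]; omega)
    omega
  have hnot : ∀ w : G, w ^ p = 1 → w ∉ Subgroup.center G → ∀ K ∈ T w, ¬ K.Normal := by
    intro w hw hwc K hK hn
    obtain ⟨t, -, rfl⟩ := Finset.mem_image.1 hK
    refine not_mem_zpowers_mul hc hc1 hcp hw hwc t
      (mem_of_normal hc h hgen hx hy hcp hn fun h0 => hwc ?_)
    rw [Subgroup.zpowers_eq_bot] at h0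
    rw [eq_inv_of_mul_eq_one_left h0]
    exact Subgroup.inv_mem _ (Subgroup.pow_mem _ hc t)
  have hdisj : Disjoint (T x) (T y) := by
    rw [Finset.disjoint_left]
    intro K h1 h2
    obtain ⟨s, -, rfl⟩ := Finset.mem_image.1 h1
    obtain ⟨t, -, ht⟩ := Finset.mem_image.1 h2
    obtain ⟨m, hm⟩ : y * c ^ t ∈ Subgroup.zpowers (x * c ^ s) := ht ▸ Subgroup.mem_zpowers _
    have h3 : Commute (x * c ^ s) (y * c ^ t) := hm ▸ (Commute.refl _).zpow_right m
    have h4 : Commute x (y * c ^ t) := by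
      have := h3.mul_left ((hcg (y * c ^ t)).pow_left s).inv_left
      rwa [mul_inv_cancel_right] at this
    have := h4.mul_right ((hcg x).symm.pow_right t).inv_right
    rw [mul_inv_cancel_right] at this
    exact hxy this
  have hsub : ((T x ∪ T y : Finset (Subgroup G)) : Set (Subgroup G)) ⊆
      {K : Subgroup G | ¬ K.Normal} := by
    intro K hK
    rcases Finset.mem_union.1 (Finset.mem_coe.1 hK) with hK | hK
    · exact hnot x hx hxc K hK
    · exact hnot y hy hyc K hK
  have := Set.ncard_le_ncard hsub (Set.toFinite _)
  rw [Set.ncard_coe_finset, Finset.card_union_of_disjoint hdisj, hcard x hx hxc,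
    hcard y hy hyc] at this
  omega

end OrderCubed

/-! ### Permutability in `p`-groups -/

theorem normal_of_le_center {G : Type*} [Group G] {N : Subgroup G} (h : N ≤ Subgroup.center G) :
    N.Normal :=
  ⟨fun n hn g => by rwa [Subgroup.mem_center_iff.1 (h hn) g, mul_inv_cancel_right]⟩

/-- A minimal counterexample is generated by two elements `x`, `y` whose cyclic groups do not
permute. Modulo a central subgroup of order `p` they do, so `⟨x⟩⟨y⟩` contains no central element of
order `p`. Hence `x ^ p = y ^ p = 1`, the commutator of `x` and `y` is central of order `p`, and
`G` is a nonabelian group of order `p ^ 3`, in which at most `p + 4` subgroups are normal and at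
least `2 * p` are not. -/
theorem MostlyNormalSections.cyclicPermute {p : ℕ} [Fact p.Prime] {G : Type u} [Group G] [Finite G]
    (h : MostlyNormalSections G) (hG : IsPGroup p G) : CyclicPermute G := by
  induction hn : Nat.card G using Nat.strong_induction_on generalizing G with
  | _ n ih =>
  by_contra hcp
  have hsub : ∀ H : Subgroup G, H ≠ ⊤ → CyclicPermute H := fun H hH =>
    ih _ (hn ▸ lt_of_le_of_ne H.card_le_card_group fun he => hH (H.eq_top_of_card_eq he))
      (h.subgroup H) (hG.to_subgroup H) rfl
  have hquo : ∀ N : Subgroup G, ∀ _ : N.Normal, N ≠ ⊥ → CyclicPermute (G ⧸ N) := fun N _ hN =>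
    ih _ (hn ▸ card_quotient_lt hN) (h.quotient N) (hG.to_quotient N) rfl
  unfold CyclicPermute at hcp
  push Not at hcp
  obtain ⟨x, y, hxy⟩ := hcp
  have hncomm : ¬ Commute x y := fun hc => hxy 1 1 (by simpa using hc.eq.symm)
  have hgen : ∀ H : Subgroup G, x ∈ H → y ∈ H → H = ⊤ := by
    intro H hxH hyH
    by_contra hH
    obtain ⟨i, j, e⟩ := hsub H hH ⟨x, hxH⟩ ⟨y, hyH⟩
    exact hxy i j (congrArg Subtype.val e)
  have hz : ∀ z ∈ Subgroup.center G, ∀ i j : ℤ, z = x ^ i * y ^ j → z = 1 := by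
    intro z hzc i j hzij
    by_contra hz1
    have hle : Subgroup.zpowers z ≤ Subgroup.center G := Subgroup.zpowers_le.2 hzc
    have hN : (Subgroup.zpowers z).Normal := normal_of_le_center hle
    obtain ⟨a, b, e⟩ := hquo (Subgroup.zpowers z) hN (mt Subgroup.zpowers_eq_bot.1 hz1) x y
    have e' : ((x ^ a * y ^ b : G) : G ⧸ Subgroup.zpowers z) = ((y * x : G)) := by
      simpa using e.symm
    obtain ⟨k, hk⟩ := QuotientGroup.eq.1 e'
    change z ^ k = _ at hk
    -- As `z` is central, `x ^ i` and `y ^ j` commute, so all powers of `z` lie in `⟨x⟩⟨y⟩` and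
    -- the relation holding modulo `⟨z⟩` lifts to `G`.
    have hcomm : Commute (x ^ i) (y ^ j) := by
      have h1 : Commute (x ^ i) z := Subgroup.mem_center_iff.1 hzc _
      have := (Commute.refl (x ^ i)).inv_right.mul_right h1
      rwa [hzij, inv_mul_cancel_left] at this
    refine hxy (a + i * k) (b + j * k) ?_
    have h2 : y * x = z ^ k * (x ^ a * y ^ b) := by
      rw [← Subgroup.mem_center_iff.1 (Subgroup.zpow_mem _ hzc k), hk, mul_inv_cancel_left]
    have h3 : Commute (z ^ k) (x ^ a) :=
      (Subgroup.mem_center_iff.1 (Subgroup.zpow_mem _ hzc k) _).symm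
    have h4 : z ^ k = x ^ (i * k) * y ^ (j * k) := by
      rw [hzij, hcomm.mul_zpow, zpow_mul, zpow_mul]
    rw [h2, ← mul_assoc, h3.eq, h4, zpow_add, add_comm b, zpow_add]
    simp only [mul_assoc]
  have hx : x ^ p = 1 := pow_eq_one_of_forall_center hG hgen hsub hncomm
    fun z hzc _ i j e => hz z hzc i j e
  have hy : y ^ p = 1 := by
    refine pow_eq_one_of_forall_center hG (fun H h1 h2 => hgen H h2 h1) hsub
      (fun hc => hncomm hc.symm) fun z hzc _ i j e => hz z hzc j i ?_
    have h1 : Commute (y ^ i) z := Subgroup.mem_center_iff.1 hzc _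
    rw [e] at h1 ⊢
    have := (Commute.refl (y ^ i)).inv_right.mul_right h1
    rw [inv_mul_cancel_left] at this
    exact this.eq
  have hnt : Nontrivial G := ⟨x, y, fun e => hncomm (e ▸ Commute.refl _)⟩
  obtain ⟨z, hzp⟩ : ∃ z : Subgroup.center G, orderOf z = p := by
    have := hG.center_nontrivial
    exact exists_prime_orderOf_dvd_card' p
      (((hG.to_subgroup (Subgroup.center G)).card_eq_or_dvd).resolve_left
        Finite.one_lt_card.ne')
  have hz1 : (z : G) ≠ 1 := fun e => by
    have : z = 1 := Subtype.ext e
    rw [this, orderOf_one] at hzp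
    exact (Fact.out : p.Prime).one_lt.ne hzp
  have hzpow : (z : G) ^ p = 1 := by
    have := pow_orderOf_eq_one z
    rw [hzp] at this
    exact congrArg Subtype.val this
  have hle : Subgroup.zpowers (z : G) ≤ Subgroup.center G := Subgroup.zpowers_le.2 z.2
  have hN : (Subgroup.zpowers (z : G)).Normal := normal_of_le_center hle
  have hcomm := (hquo _ hN (mt Subgroup.zpowers_eq_bot.1 hz1)).commute (hG.to_quotient _)
    (a := (x : G ⧸ Subgroup.zpowers (z : G))) (b := (y : G ⧸ Subgroup.zpowers (z : G)))
    (by rw [← QuotientGroup.mk_pow, hx, QuotientGroup.mk_one])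
    (by rw [← QuotientGroup.mk_pow, hy, QuotientGroup.mk_one])
  have hmem : (x * y)⁻¹ * (y * x) ∈ Subgroup.zpowers (z : G) :=
    QuotientGroup.eq.1 (by simpa using hcomm.eq)
  have e : y * x = x * y * ((x * y)⁻¹ * (y * x)) := (mul_inv_cancel_left _ _).symm
  have hc1 : (x * y)⁻¹ * (y * x) ≠ 1 := fun h1 =>
    hncomm (inv_mul_eq_one.1 h1)
  have hcpow : ((x * y)⁻¹ * (y * x)) ^ p = 1 := by
    obtain ⟨k, hk⟩ := hmem
    change (z : G) ^ k = _ at hk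
    rw [← hk, ← zpow_natCast, ← zpow_mul, mul_comm, zpow_mul, zpow_natCast, hzpow, one_zpow]
  have h1 := ncard_normal_le (hle hmem) e hgen hx hy hcpow
  have h2 := two_mul_le_ncard_not_normal (hle hmem) e hc1 hgen hx hy hcpow
  have h3 := h G (IsSection.refl G)
  have h4 := (Fact.out : p.Prime).two_le
  omega

/-! ### Modularity of the subgroup lattice -/

/-- An element of a finite group is a product of powers of prime power order. -/
theorem mem_submonoid_of_prime_pow {G : Type*} [Group G] [Finite G] (S : Submonoid G) {g : G}
    (h : ∀ p k : ℕ, p.Prime → ∀ a ∈ Subgroup.zpowers g, orderOf a = p ^ k → a ∈ S) : g ∈ S := by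
  induction hn : orderOf g using Nat.recOnPrimeCoprime generalizing g with
  | zero => exact absurd hn (orderOf_pos g).ne'
  | prime_pow p k hp => exact h p k hp g (Subgroup.mem_zpowers g) hn
  | coprime m n hm1 hn1 hmn ihm ihn =>
    have hpow : ∀ d : ℕ, g ^ d ∈ S → ∀ u : ℤ, (g ^ d) ^ u ∈ S := fun d hd u =>
      Submonoid.powers_le.2 hd (mem_powers_iff_mem_zpowers.2 ⟨u, rfl⟩)
    have hsub : ∀ d : ℕ, ∀ p k : ℕ, p.Prime → ∀ a ∈ Subgroup.zpowers (g ^ d),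
        orderOf a = p ^ k → a ∈ S := fun d p k hp a ha =>
      h p k hp a (Subgroup.zpowers_le.2 (Subgroup.pow_mem _ (Subgroup.mem_zpowers g) d) ha)
    have hmS : g ^ m ∈ S := ihn (hsub m) <| by
      rw [orderOf_pow_of_dvd (by omega) (hn ▸ dvd_mul_right m n), hn,
        Nat.mul_div_cancel_left _ (by omega)]
    have hnS : g ^ n ∈ S := ihm (hsub n) <| by
      rw [orderOf_pow_of_dvd (by omega) (hn ▸ dvd_mul_left n m), hn,
        Nat.mul_div_cancel _ (by omega)]
    obtain ⟨u, v, huv⟩ := Nat.isCoprime_iff_coprime.2 hmn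
    have : g = (g ^ m) ^ u * (g ^ n) ^ v := by
      conv_lhs => rw [← zpow_one g, ← huv, zpow_add, mul_comm u, mul_comm v, zpow_mul, zpow_mul,
        zpow_natCast, zpow_natCast]
    exact this ▸ S.mul_mem (hpow m hmS u) (hpow n hnS v)

/-- Elements of prime power order lie in the normal Sylow subgroups, where the statement for
`p`-groups applies, and elements of coprime orders commute. -/
theorem MostlyNormalSections.exists_mul_eq_of_orderOf_eq {G : Type u} [Group G] [Finite G]
    (h : MostlyNormalSections G) {p q a b : ℕ} (hp : p.Prime) (hq : q.Prime) {x y : G}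
    (hx : orderOf x = p ^ a) (hy : orderOf y = q ^ b) : ∃ i j : ℤ, y * x = x ^ i * y ^ j := by
  have := h.isNilpotent
  have := Fact.mk hp
  have := Fact.mk hq
  obtain ⟨P, hP⟩ := (IsPGroup.of_card (p := p)
    ((Nat.card_zpowers x).trans hx)).exists_le_sylow
  obtain ⟨Q, hQ⟩ := (IsPGroup.of_card (p := q)
    ((Nat.card_zpowers y).trans hy)).exists_le_sylow
  rw [Subgroup.zpowers_le] at hP hQ
  have hPn : (P : Subgroup G).Normal := inferInstance
  have hQn : (Q : Subgroup G).Normal := inferInstance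
  by_cases hpq : p = q
  · subst hpq
    have := Sylow.unique_of_normal P hPn
    obtain rfl : P = Q := Subsingleton.elim _ _
    obtain ⟨i, j, e⟩ := (h.subgroup (P : Subgroup G)).cyclicPermute P.isPGroup' ⟨x, hP⟩ ⟨y, hQ⟩
    exact ⟨i, j, congrArg Subtype.val e⟩
  · have hc := Subgroup.commute_of_normal_of_disjoint _ _ hPn hQn
      (IsPGroup.disjoint_of_ne p q hpq _ _ P.isPGroup' Q.isPGroup') x y hP hQ
    exact ⟨1, 1, by simpa using hc.eq.symm⟩

theorem MostlyNormalSections.exists_mul_eq {G : Type u} [Group G] [Finite G]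
    (h : MostlyNormalSections G) (X Y : Subgroup G) :
    ∀ x ∈ X, ∀ y ∈ Y, ∃ x' ∈ X, ∃ y' ∈ Y, y * x = x' * y' := by
  -- The conditions `Y * a ⊆ X * Y` on `a ∈ X` and `b * ⟨x⟩ ⊆ ⟨x⟩ * Y` on `b ∈ Y` each define a
  -- submonoid, so that both elements may be taken of prime power order.
  have key : ∀ (p k : ℕ) (x : G), p.Prime → orderOf x = p ^ k → ∀ y ∈ Y,
      ∃ x' ∈ Subgroup.zpowers x, ∃ y' ∈ Y, y * x = x' * y' := by
    intro p k x hp hx y hy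
    let S : Submonoid G :=
      { carrier := {b | ∀ u ∈ Subgroup.zpowers x, ∃ x' ∈ Subgroup.zpowers x, ∃ y' ∈ Y,
          b * u = x' * y'}
        one_mem' := fun u hu => ⟨u, hu, 1, Y.one_mem, by simp⟩
        mul_mem' := by
          intro b b' hb hb' u hu
          obtain ⟨u₁, hu₁, y₁, hy₁, e₁⟩ := hb' u hu
          obtain ⟨u₂, hu₂, y₂, hy₂, e₂⟩ := hb u₁ hu₁
          exact ⟨u₂, hu₂, y₂ * y₁, Y.mul_mem hy₂ hy₁, by
            rw [mul_assoc, e₁, ← mul_assoc, e₂, mul_assoc]⟩ }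
    refine (mem_submonoid_of_prime_pow S (g := y) fun q l hq b hb hbo u hu => ?_) x
      (Subgroup.mem_zpowers x)
    obtain ⟨m, -, hm⟩ := (Nat.dvd_prime_pow hp).1 (hx ▸ orderOf_dvd_of_mem_zpowers hu)
    obtain ⟨i, j, e⟩ := h.exists_mul_eq_of_orderOf_eq hp hq hm hbo
    exact ⟨u ^ i, Subgroup.zpow_mem _ hu i, b ^ j,
      Y.zpow_mem (Subgroup.zpowers_le.2 hy hb) j, e⟩
  intro x hx
  let S : Submonoid G :=
    { carrier := {a | ∀ y ∈ Y, ∃ x' ∈ X, ∃ y' ∈ Y, y * a = x' * y'}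
      one_mem' := fun y hy => ⟨1, X.one_mem, y, hy, by simp⟩
      mul_mem' := by
        intro a a' ha ha' y hy
        obtain ⟨x₁, hx₁, y₁, hy₁, e₁⟩ := ha y hy
        obtain ⟨x₂, hx₂, y₂, hy₂, e₂⟩ := ha' y₁ hy₁
        exact ⟨x₁ * x₂, X.mul_mem hx₁ hx₂, y₂, hy₂, by
          rw [← mul_assoc, e₁, mul_assoc, e₂, mul_assoc]⟩ }
  refine mem_submonoid_of_prime_pow S (g := x) fun p k hp a ha hao y hy => ?_
  obtain ⟨x', hx', y', hy', e⟩ := key p k a hp hao y hy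
  exact ⟨x', (Subgroup.zpowers_le.2 hx) ((Subgroup.zpowers_le.2 ha) hx'), y', hy', e⟩

theorem isModularLattice_of_permute {G : Type*} [Group G]
    (h : ∀ X Y : Subgroup G, ∀ x ∈ X, ∀ y ∈ Y, ∃ x' ∈ X, ∃ y' ∈ Y, y * x = x' * y') :
    IsModularLattice (Subgroup G) where
  sup_inf_le_assoc_of_le {X} Y Z hXZ := by
    rintro g ⟨hg, hgZ⟩
    obtain ⟨x, hx, y, hy, rfl⟩ := exists_mul_eq_of_mem_sup (h X Y) hg
    exact Subgroup.mul_mem_sup hx ⟨hy, (Z.mul_mem_cancel_left (hXZ hx)).1 hgZ⟩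

theorem MostlyNormalSections.isIwasawa {G : Type u} [Group G] [Finite G]
    (h : MostlyNormalSections G) : IsIwasawa G :=
  ⟨h.isNilpotent, isModularLattice_of_permute h.exists_mul_eq⟩

/-! ### The dihedral group of order `8` -/

theorem dPrime_eq_one_of_comm {K : Type*} [Group K] [Finite K] (h : ∀ u v : K, u * v = v * u) :
    dPrime K = 1 := by
  have hn : ∀ A : Subgroup K, A.Normal := fun A =>
    ⟨fun a ha g => by rwa [h g a, mul_inv_cancel_right]⟩
  have h1 : numSubgroupClasses K = Nat.card (Subgroup K) :=
    (Nat.card_congr (Equiv.ofBijective _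
      ⟨fun A B hAB => eq_of_orbitRel_of_normal (Quotient.exact hAB) (hn B),
        Quotient.mk_surjective⟩)).symm
  rw [dPrime, h1, div_self (by exact_mod_cast Nat.card_pos.ne')]

/-- The subgroups of the dihedral group of order `8`, as explicit sets of elements. -/
abbrev DihedralSubgroup : Type :=
  {s : Finset (DihedralGroup 4) // 1 ∈ s ∧ (∀ a ∈ s, ∀ b ∈ s, a * b ∈ s) ∧ ∀ a ∈ s, a⁻¹ ∈ s}

open Classical in
/-- A subgroup of the dihedral group of order `8` as its set of elements. -/
noncomputable def subgroupEquivDihedralSubgroup :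
    Subgroup (DihedralGroup 4) ≃ DihedralSubgroup where
  toFun H := ⟨Finset.univ.filter (· ∈ H), by simp,
    fun a ha b hb => by simp at ha hb ⊢; exact H.mul_mem ha hb,
    fun a ha => by simp at ha ⊢; exact ha⟩
  invFun s :=
    { carrier := s.1
      one_mem' := s.2.1
      mul_mem' := fun ha hb => s.2.2.1 _ ha _ hb
      inv_mem' := fun ha => s.2.2.2 _ ha }
  left_inv H := by ext; simp
  right_inv s := by ext; simp

/-- Conjugacy of subgroups of the dihedral group of order `8`, in a decidable form. -/
noncomputable def dihedralConj : Setoid DihedralSubgroup :=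
  (MulAction.orbitRel (ConjAct (DihedralGroup 4)) (Subgroup (DihedralGroup 4))).comap
    subgroupEquivDihedralSubgroup.symm

theorem dihedralConj_iff (s t : DihedralSubgroup) :
    dihedralConj s t ↔ ∃ g : DihedralGroup 4, t.1.image (fun a => g * a * g⁻¹) = s.1 := by
  refine (orbitRel_iff _ _).trans (exists_congr fun g => ?_)
  rw [← SetLike.coe_set_eq, ← Finset.coe_inj, Finset.coe_image]
  exact Iff.rfl

instance : DecidableRel dihedralConj.r := fun s t => decidable_of_iff _ (dihedralConj_iff s t).symm

theorem card_subgroup_dihedral : Nat.card (Subgroup (DihedralGroup 4)) = 10 := by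
  rw [Nat.card_congr subgroupEquivDihedralSubgroup, Nat.card_eq_fintype_card]
  decide +kernel

theorem numSubgroupClasses_dihedral : numSubgroupClasses (DihedralGroup 4) = 8 := by
  have : numSubgroupClasses (DihedralGroup 4) = Nat.card (Quotient dihedralConj) :=
    Nat.card_congr (Quotient.congr subgroupEquivDihedralSubgroup fun A B => by
      change _ ↔ MulAction.orbitRel _ _ _ _
      rw [Equiv.symm_apply_apply, Equiv.symm_apply_apply])
  rw [this, Nat.card_eq_fintype_card]
  decide +kernel

theorem dPrime_dihedral : dPrime (DihedralGroup 4) = 4 / 5 := by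
  rw [dPrime, numSubgroupClasses_dihedral, card_subgroup_dihedral]
  norm_num

/-- A section of the dihedral group of order `8` is either the whole group or abelian. -/
theorem dStar_dihedral : dStar (DihedralGroup 4) = 4 / 5 := by
  refine (isLeast_dStar (DihedralGroup 4)).unique ⟨?_, ?_⟩
  · refine ⟨⊤, ⊥, inferInstance, ?_⟩
    rw [← dPrime_dihedral]
    exact dPrime_congr (QuotientGroup.quotientBot.trans Subgroup.topEquiv).symm
  · rintro _ ⟨H, N, hN, rfl⟩
    have hG : Nat.card (DihedralGroup 4) = 2 ^ 3 := by rw [DihedralGroup.nat_card]; rfl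
    have h1 := N.card_eq_card_quotient_mul_card_subgroup
    have h2 : Nat.card H ∣ 2 ^ 3 := hG ▸ H.card_subgroup_dvd_card
    obtain ⟨n, hn3, hn⟩ := (Nat.dvd_prime_pow Nat.prime_two).1 ((Dvd.intro _ h1.symm).trans h2)
    rcases hn3.lt_or_eq with hlt | rfl
    · rw [dPrime_eq_one_of_comm (mul_comm_of_card_eq_prime_pow (p := 2) (by omega) hn)]
      norm_num
    · have h3 := Nat.le_of_dvd (by norm_num) h2
      have h4 : 0 < Nat.card N := Nat.card_pos
      rw [hn] at h1
      have hN1 : Nat.card N = 1 := by omega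
      have hH : Nat.card H = 2 ^ 3 := by rw [h1, hN1, mul_one]
      obtain rfl : H = ⊤ := H.eq_top_of_card_eq (hH.trans hG.symm)
      obtain rfl : N = ⊥ := N.card_eq_one.1 hN1
      rw [← dPrime_dihedral]
      exact (dPrime_congr (QuotientGroup.quotientBot.trans Subgroup.topEquiv)).ge

end FiniteGroupRatio

theorem theoremC :
    FiniteGroupRatio.dStar (DihedralGroup 4) = 4 / 5 ∧
    FiniteGroupRatio.dPrime (DihedralGroup 4) = 4 / 5 ∧
    ∀ (G : Type*) [Group G] [Finite G],
      4 / 5 < FiniteGroupRatio.dStar G → FiniteGroupRatio.IsIwasawa G :=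
  ⟨FiniteGroupRatio.dStar_dihedral, FiniteGroupRatio.dPrime_dihedral, fun _ _ _ h =>
    (FiniteGroupRatio.mostlyNormalSections_of_lt_dStar h).isIwasawa⟩
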